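/- Let $H$ be a complex Hilbert space with inner product $(\cdot,\cdot)$, linear in the first argument. A linear operator $A$ in $H$ is accretive if $\mathrm{Re}\,(Au,u)\ge 0$ for all $u\in\mathrm{dom}\,A$; it is $m$-accretive if in addition it is densely defined and $\mathrm{ran}(A-\lambda I)=H$ for some $\lambda\in\mathbb C$ with $\mathrm{Re}\,\lambda<0$. For $\alpha\in[0,\pi/2)$, $A$ is $\alpha$-sectorial if $|\arg (Au,u)|\le\alpha$ for all $u\in\mathrm{dom}\,A$ with $\|u\|=1$ and $(Au,u)\neq 0$, and sectorial if it is $\alpha$-sectorial for some $\alpha\in[0,\pi/2)$. The square root $A^{1/2}$ of an $m$-accretive operator $A$ is its unique $m$-accretive square root. Products of unbounded operators have their natural domains, $A^{*1/2}:=(A^*)^{1/2}$ and $A^{*-1/2}:=\big((A^*)^{1/2}\big)^{-1}$. For bounded $A$ put $\mathrm{Re}\,A=\frac12(A+A^*)$. A subspace is a closed linear manifold, and $P_{L}$ is the orthogonal projection onto the subspace $L$. Theorem. Let $Q$ be a bounded nonnegative selfadjoint operator in $H$ with $\ker Q=\{0\}$ and $\mathrm{ran}\,Q\ne H$, and let $M\subsetneq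 H$ be a subspace such that $M^\perp\cap\mathrm{ran}\,Q=\{0\}$. Set $$T_0=Q+i\,(QP_MQ)^{1/2}.$$ Then: (a) $T_0$ is bounded and $\frac{\pi}{4}$-sectorial, and $\ker T_0=\{0\}$; (b) $M^\perp\cap\mathrm{ran}\,T_0=M^\perp\cap\mathrm{ran}\,T_0^*=\{0\}$; (c) $\mathrm{ran}\,T_0\neq\mathrm{ran}\,T_0^*$; (d) $T_0^2=QP_{M^\perp}Q+i\big(Q(QP_MQ)^{1/2}+(QP_MQ)^{1/2}Q\big)$, and $T_0^2$ is accretive and not sectorial; (e) the following are equivalent: (i) $M\cap\mathrm{ran}\,Q=\{0\}$; (ii) $\ker\mathrm{Re}(T_0^2)=\{0\}$; (iii) $\mathrm{ran}\,T_0^2\cap\mathrm{ran}\,T_0^{*2}=\{0\}$. Moreover, let $B_0:=(T_0^2)^{-1}$, with domain $\mathrm{ran}\,T_0^2$. Then: (1) $B_0$ is $m$-accretive and not sectorial; (2) each of $B_0$ and $B_0^*$ has exactly one $m$-accretive square root, and $\mathrm{dom}\,B_0^{1/2}\ne\mathrm{dom}\,B_0^{*1/2}$; (3) the operator $F_0:=B_0^{1/2}B_0^{*-1/2}$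 is $m$-accretive, $\mathrm{Re}\,(F_0h,h)=0$ for all $h\in\mathrm{dom}\,F_0$, $\mathrm{dom}\,F_0\subsetneq\mathrm{dom}\,F_0^*$, and $iF_0$ is maximal symmetric (densely defined and symmetric, without proper symmetric extensions) but not selfadjoint; (4) $\mathrm{dom}\,B_0\cap\mathrm{dom}\,B_0^*=\{0\}$ if and only if $M\cap\mathrm{ran}\,Q=\{0\}$. -/

import Mathlib

open scoped ComplexConjugate InnerProductSpace LinearPMap

/-! Operators in a complex Hilbert space `H` are partially defined linear maps `H →ₗ.[ℂ] H`.
The inner product `(u, v)`, linear in `u`, is `inner ℂ v u` in Mathlib's convention. -/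

namespace LinearPMap

section Product

variable {H : Type*} [AddCommGroup H] [Module ℂ H]

/-- The natural domain `{x ∈ dom B | B x ∈ dom A}` of the product `A B`. -/
def prodDomain (A B : H →ₗ.[ℂ] H) : Submodule ℂ H :=
  (A.domain.comap B.toFun).map B.domain.subtype

theorem mem_prodDomain {A B : H →ₗ.[ℂ] H} {x : H} :
    x ∈ A.prodDomain B ↔ ∃ hx : x ∈ B.domain, B ⟨x, hx⟩ ∈ A.domain := by
  constructor
  · rintro ⟨⟨y, hy⟩, h, rfl⟩
    exact ⟨hy, h⟩
  · rintro ⟨hx, h⟩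
    exact ⟨⟨x, hx⟩, h, rfl⟩

theorem domRestrict_prodDomain_mem (A B : H →ₗ.[ℂ] H)
    (x : (B.domRestrict (A.prodDomain B)).domain) :
    B.domRestrict (A.prodDomain B) x ∈ A.domain := by
  obtain ⟨hx, h⟩ := mem_prodDomain.1 x.2.1
  have e : B.domRestrict (A.prodDomain B) x = B ⟨x, hx⟩ := domRestrict_apply rfl
  rw [e]
  exact h

/-- The product `A B` of two operators, on `{x ∈ dom B | B x ∈ dom A}`. -/
def opProd (A B : H →ₗ.[ℂ] H) : H →ₗ.[ℂ] H :=
  A.comp (B.domRestrict (A.prodDomain B)) (domRestrict_prodDomain_mem A B)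

theorem mem_opProd_domain {A B : H →ₗ.[ℂ] H} {x : H} :
    x ∈ (A.opProd B).domain ↔ ∃ hx : x ∈ B.domain, B ⟨x, hx⟩ ∈ A.domain :=
  ⟨fun h => mem_prodDomain.1 h.1, fun h => ⟨mem_prodDomain.2 h, h.1⟩⟩

theorem opProd_apply {A B : H →ₗ.[ℂ] H} (x : (A.opProd B).domain) (hx : (x : H) ∈ B.domain)
    (h : B ⟨x, hx⟩ ∈ A.domain) : A.opProd B x = A ⟨B ⟨x, hx⟩, h⟩ := rfl

end Product

variable {H : Type*} [NormedAddCommGroup H] [InnerProductSpace ℂ H]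

/-- The numerical range `{(A u, u) | u ∈ dom A, ‖u‖ = 1}`. -/
def numericalRange (A : H →ₗ.[ℂ] H) : Set ℂ :=
  {z | ∃ u : A.domain, ‖(u : H)‖ = 1 ∧ z = inner ℂ (u : H) (A u)}

/-- `A` is accretive: `Re (A u, u) ≥ 0` for all `u ∈ dom A`. -/
def IsAccretive (A : H →ₗ.[ℂ] H) : Prop :=
  ∀ u : A.domain, 0 ≤ (inner ℂ (u : H) (A u)).re

/-- `A` is `α`-sectorial (with vertex `0`): `0 ≤ α < π / 2` and the numerical range of `A` lies in
the sector `|arg z| ≤ α`. -/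
def IsSectorialWith (A : H →ₗ.[ℂ] H) (α : ℝ) : Prop :=
  0 ≤ α ∧ α < Real.pi / 2 ∧ A.numericalRange ⊆ {z : ℂ | |z.arg| ≤ α}

/-- `A` is sectorial (with vertex `0`) if it is `α`-sectorial for some `α ∈ [0, π / 2)`. -/
def IsSectorial (A : H →ₗ.[ℂ] H) : Prop :=
  ∃ α : ℝ, A.IsSectorialWith α

/-- `A` is maximal accretive (`m`-accretive): it is accretive and densely defined, and
`ran (A - λ I) = H` for some `λ` with `Re λ < 0`. -/
def IsMAccretive (A : H →ₗ.[ℂ] H) : Prop :=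
  A.IsAccretive ∧ Dense (A.domain : Set H) ∧
    ∃ l : ℂ, l.re < 0 ∧ ∀ y : H, ∃ x : A.domain, A x - l • (x : H) = y

/-- `S` is an `m`-accretive square root of `B`: `S` is `m`-accretive and `S S = B`, equality of
domains included. -/
def IsMAccretiveSqrt (B S : H →ₗ.[ℂ] H) : Prop :=
  S.IsMAccretive ∧ S.opProd S = B

open Classical in
/-- The square root `B^{1/2}` of an `m`-accretive operator `B`, that is, its `m`-accretive square
root (which is unique); the value is irrelevant if there is none. -/
noncomputable def accretiveSqrt (B : H →ₗ.[ℂ] H) : H →ₗ.[ℂ] H :=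
  if h : ∃ S : H →ₗ.[ℂ] H, B.IsMAccretiveSqrt S then h.choose else ⊥

/-- `A` is a (densely defined) symmetric operator. -/
def IsSymmetricOp (A : H →ₗ.[ℂ] H) : Prop :=
  Dense (A.domain : Set H) ∧
    ∀ u v : A.domain, inner ℂ (A u) (v : H) = inner ℂ (u : H) (A v)

/-- `A` is maximal symmetric: symmetric without proper symmetric extensions. -/
def IsMaximalSymmetric (A : H →ₗ.[ℂ] H) : Prop :=
  A.IsSymmetricOp ∧ ∀ A' : H →ₗ.[ℂ] H, A'.IsSymmetricOp → A ≤ A' → A' = A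

end LinearPMap

namespace KatoExample

variable {H : Type*} [NormedAddCommGroup H] [InnerProductSpace ℂ H]

/-- A bounded operator on `H`, regarded as an operator with domain `H`. -/
def toOp (T : H →L[ℂ] H) : H →ₗ.[ℂ] H :=
  (T : H →ₗ[ℂ] H).toPMap ⊤

variable [CompleteSpace H]

/-- The real part `(A + A*) / 2` of a bounded operator. -/
noncomputable def rePart (A : H →L[ℂ] H) : H →L[ℂ] H :=
  (1 / 2 : ℂ) • (A + ContinuousLinearMap.adjoint A)

/-- The nonnegative square root `(Q P_M Q)^{1/2}`. -/
noncomputable def rootQPQ (Q : H →L[ℂ] H) (M : Submodule ℂ H) [M.HasOrthogonalProjection] :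
    H →L[ℂ] H :=
  CFC.sqrt (Q * M.starProjection * Q)

/-- `T₀ = Q + i (Q P_M Q)^{1/2}`. -/
noncomputable def T₀ (Q : H →L[ℂ] H) (M : Submodule ℂ H) [M.HasOrthogonalProjection] :
    H →L[ℂ] H :=
  Q + Complex.I • rootQPQ Q M

/-- `B₀ = (T₀²)⁻¹`, with domain `ran T₀²`. -/
noncomputable def B₀ (Q : H →L[ℂ] H) (M : Submodule ℂ H) [M.HasOrthogonalProjection] :
    H →ₗ.[ℂ] H :=
  (toOp (T₀ Q M ^ 2)).inverse

/-- The operator `B₀^{1/2} B₀*^{-1/2}`, where `B₀*^{-1/2}` is the inverse of `(B₀*)^{1/2}`. -/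
noncomputable def F₀ (Q : H →L[ℂ] H) (M : Submodule ℂ H) [M.HasOrthogonalProjection] :
    H →ₗ.[ℂ] H :=
  (B₀ Q M).accretiveSqrt.opProd ((B₀ Q M)†.accretiveSqrt).inverse

end KatoExample

/-! ### Graphs of products and adjoints -/

namespace LinearPMap

/-! Since `‖(Q P_M Q)^{1/2} x‖ = ‖P_M Q x‖`, polar decomposition gives an isometry `W` with `(Q P_M
Q)^{1/2} = Q W = W* Q` and `W W* = P_M`; the condition on `Mᗮ ∩ ran Q` makes the root injective, so
`W` is defined everywhere. Hence `T₀ = Q (1 + i W)` and `T₀* = Q (1 - i W)`, and as `M ≠ H` there is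
a nonzero `m` in `ker W* = Mᗮ`. This vector drives all the negative assertions.

If the ranges of `T₀` and `T₀*` agreed, then `Q m`, half the sum of `T₀ m` and `T₀* m`, would force
`m ∈ ran (1 + i W)`, which meets `ker W*` only in `0`. The form of `T₀²` has real part `‖Qx‖² - ‖W*
Qx‖²`, which degenerates on `ran W`; a sector bound would give `W + W* = 0`, impossible on `m`.

In `F₀ = T₀⁻¹ T₀*` the factor `Q` cancels, leaving the inverse Cayley transform `(1 + i W)⁻¹ (1 - i
W)` of a nonunitary isometry: skew-symmetric with `ran (F₀ + 1) = H`, hence maximal, while `F₀* m =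
m` (`IsCayleyInverse`).

All of this needs `B₀^{1/2} = T₀⁻¹`, that is, uniqueness of accretive roots (`eq_of_sq_eq_sq`),
obtained from Cayley transform orbits and the bound `‖T₀ x‖² ≤ C Re (T₀ x, x)`. -/

theorem mem_graph_opProd {H : Type*} [AddCommGroup H] [Module ℂ H] {A B : H →ₗ.[ℂ] H} {x z : H} :
    (x, z) ∈ (A.opProd B).graph ↔ ∃ y, (x, y) ∈ B.graph ∧ (y, z) ∈ A.graph := by
  constructor
  · intro h
    obtain ⟨⟨x', hx'⟩, rfl, rfl⟩ := (mem_graph_iff _).1 h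
    obtain ⟨hx, hy⟩ := mem_opProd_domain.1 hx'
    exact ⟨B ⟨x', hx⟩, mem_graph B ⟨x', hx⟩, mem_graph A ⟨_, hy⟩⟩
  · rintro ⟨y, hB, hA⟩
    obtain ⟨⟨x', hx⟩, rfl, rfl⟩ := (mem_graph_iff _).1 hB
    obtain ⟨⟨y', hy⟩, e, rfl⟩ := (mem_graph_iff _).1 hA
    dsimp only at e
    subst e
    exact mem_graph (A.opProd B) ⟨x', mem_opProd_domain.2 ⟨hx, hy⟩⟩

variable {H : Type*} [NormedAddCommGroup H] [InnerProductSpace ℂ H]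

theorem isAccretive_iff_graph {A : H →ₗ.[ℂ] H} :
    A.IsAccretive ↔ ∀ x y, (x, y) ∈ A.graph → 0 ≤ (inner ℂ x y).re := by
  constructor
  · intro h x y hxy
    obtain ⟨u, rfl, rfl⟩ := (mem_graph_iff _).1 hxy
    exact h u
  · intro h u
    exact h _ _ (mem_graph A u)

theorem mem_graph_adjoint [CompleteSpace H] {A : H →ₗ.[ℂ] H} (hA : Dense (A.domain : Set H))
    {x y : H} :
    (x, y) ∈ A†.graph ↔ ∀ a b, (a, b) ∈ A.graph → inner ℂ x b = inner ℂ y a := by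
  constructor
  · intro h a b hab
    obtain ⟨u, rfl, rfl⟩ := (mem_graph_iff _).1 h
    obtain ⟨v, rfl, rfl⟩ := (mem_graph_iff _).1 hab
    exact (adjoint_isFormalAdjoint hA u v).symm
  · intro h
    have hx : x ∈ A†.domain := mem_adjoint_domain_of_exists x
      ⟨y, fun u => (h _ _ (mem_graph A u)).symm⟩
    have e : A† ⟨x, hx⟩ = y := adjoint_apply_eq hA _ fun u => (h _ _ (mem_graph A u)).symm
    exact (mem_graph_iff _).2 ⟨⟨x, hx⟩, rfl, e⟩

end LinearPMap

namespace KatoExample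

variable {H : Type*} [NormedAddCommGroup H] [InnerProductSpace ℂ H]

/-! ### Inverses of injective bounded operators -/

section Inverse

open LinearPMap

theorem ker_toOp {A : H →L[ℂ] H} (hA : LinearMap.ker (A : H →ₗ[ℂ] H) = ⊥) :
    LinearMap.ker (toOp A).toFun = ⊥ := by
  rw [LinearMap.ker_eq_bot'] at hA ⊢
  intro x hx
  exact Subtype.ext (hA x hx)

theorem mem_graph_inverse_toOp {A : H →L[ℂ] H} (hA : LinearMap.ker (A : H →ₗ[ℂ] H) = ⊥)
    {x y : H} : (x, y) ∈ (toOp A).inverse.graph ↔ A y = x := by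
  rw [inverse_graph (ker_toOp hA)]
  constructor
  · rintro ⟨⟨a, b⟩, hab, e⟩
    obtain ⟨u, rfl, rfl⟩ := (mem_graph_iff _).1 hab
    obtain ⟨rfl, rfl⟩ := Prod.mk.inj e
    rfl
  · rintro rfl
    exact ⟨(y, A y), mem_graph (toOp A) ⟨y, trivial⟩, rfl⟩

theorem domain_inverse_toOp (A : H →L[ℂ] H) :
    (toOp A).inverse.domain = LinearMap.range (A : H →ₗ[ℂ] H) := by
  rw [inverse_domain]
  ext x
  constructor
  · rintro ⟨u, rfl⟩
    exact ⟨u, rfl⟩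
  · rintro ⟨u, rfl⟩
    exact ⟨⟨u, trivial⟩, rfl⟩

theorem inverse_inverse_toOp {A : H →L[ℂ] H} (hA : LinearMap.ker (A : H →ₗ[ℂ] H) = ⊥) {x y : H} :
    (x, y) ∈ (toOp A).inverse.inverse.graph ↔ A x = y := by
  have hk : LinearMap.ker (toOp A).inverse.toFun = ⊥ := by
    rw [LinearMap.ker_eq_bot']
    intro u hu
    have h := (mem_graph_inverse_toOp hA).1 (mem_graph (toOp A).inverse u)
    have hu' : (toOp A).inverse u = 0 := hu
    rw [hu', _root_.map_zero] at h
    exact Subtype.ext h.symm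
  rw [inverse_graph hk]
  constructor
  · rintro ⟨⟨a, b⟩, hab, e⟩
    obtain ⟨rfl, rfl⟩ := Prod.mk.inj e
    exact (mem_graph_inverse_toOp hA).1 hab
  · rintro rfl
    exact ⟨(A x, x), (mem_graph_inverse_toOp hA).2 rfl, rfl⟩

theorem ker_pow_two {A : H →L[ℂ] H} (hA : LinearMap.ker (A : H →ₗ[ℂ] H) = ⊥) :
    LinearMap.ker ((A ^ 2 : H →L[ℂ] H) : H →ₗ[ℂ] H) = ⊥ := by
  rw [LinearMap.ker_eq_bot'] at hA ⊢
  intro x hx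
  refine hA x (hA _ ?_)
  simpa [pow_two] using hx

theorem opProd_inverse_toOp {A : H →L[ℂ] H} (hA : LinearMap.ker (A : H →ₗ[ℂ] H) = ⊥) :
    (toOp A).inverse.opProd (toOp A).inverse = (toOp (A ^ 2)).inverse := by
  refine eq_of_eq_graph ?_
  ext ⟨x, z⟩
  rw [mem_graph_opProd, mem_graph_inverse_toOp (ker_pow_two hA)]
  simp only [mem_graph_inverse_toOp hA]
  constructor
  · rintro ⟨y, rfl, rfl⟩
    simp [pow_two]
  · rintro rfl
    exact ⟨A z, by simp [pow_two], rfl⟩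

end Inverse

/-! ### Accretive operators and uniqueness of their square roots -/

variable [CompleteSpace H]

omit [CompleteSpace H] in
theorem re_inner_self (x : H) : (inner ℂ x x).re = ‖x‖ ^ 2 := by
  rw [inner_self_eq_norm_sq_to_K]; norm_cast

/-- Lax–Milgram: accretivity makes `1 + A` coercive with constant `1`. -/
theorem surjective_add_of_accretive {A : H →L[ℂ] H} (hA : ∀ x, 0 ≤ (inner ℂ x (A x)).re) (y : H) :
    ∃ x, x + A x = y := by
  have h : IsUnit (1 + A : H →L[ℂ] H) := by
    refine ContinuousLinearMap.isUnit_of_forall_le_norm_inner_map (c := 1) _ one_pos fun x => ?_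
    refine le_trans ?_ (Complex.abs_re_le_norm _)
    refine le_trans ?_ (le_abs_self _)
    have h1 := hA x
    have h2 : (inner ℂ (A x) x).re = (inner ℂ x (A x)).re := by
      rw [← inner_conj_symm, Complex.conj_re]
    simp only [_root_.add_apply, one_apply_eq_self, inner_add_left,
      Complex.add_re, h2, re_inner_self, NNReal.coe_one]
    linarith
  obtain ⟨x, hx⟩ := (ContinuousLinearMap.isUnit_iff_bijective.1 h).2 y
  exact ⟨x, by simpa using hx⟩

open LinearPMap

theorem denseRange_iff_ker_adjoint {A : H →L[ℂ] H} :
    DenseRange A ↔ LinearMap.ker (ContinuousLinearMap.adjoint A : H →ₗ[ℂ] H) = ⊥ := by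
  have h := A.orthogonal_range
  have h2 : DenseRange A ↔ Dense ((LinearMap.range (A : H →ₗ[ℂ] H) : Submodule ℂ H) : Set H) := by
    rw [DenseRange, LinearMap.coe_range]; rfl
  rw [h2, Submodule.dense_iff_topologicalClosure_eq_top, Submodule.topologicalClosure_eq_top_iff, h]

omit [CompleteSpace H] in
theorem dense_domain_inverse_toOp {A : H →L[ℂ] H} (hd : DenseRange A) :
    Dense ((toOp A).inverse.domain : Set H) := by
  rw [domain_inverse_toOp, LinearMap.coe_range]
  exact hd

theorem isMAccretive_inverse_toOp {A : H →L[ℂ] H} (hA : ∀ x, 0 ≤ (inner ℂ x (A x)).re)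
    (hk : LinearMap.ker (A : H →ₗ[ℂ] H) = ⊥) (hd : DenseRange A) :
    (toOp A).inverse.IsMAccretive := by
  refine ⟨isAccretive_iff_graph.2 fun x y h => ?_, dense_domain_inverse_toOp hd, -1, by simp,
    fun y => ?_⟩
  · rw [mem_graph_inverse_toOp hk] at h
    subst h
    rw [← inner_conj_symm, Complex.conj_re]
    exact hA y
  · obtain ⟨x, hx⟩ := surjective_add_of_accretive hA y
    obtain ⟨u, e1, e2⟩ := (mem_graph_iff _).1 ((mem_graph_inverse_toOp hk).2 (rfl : A x = A x))
    exact ⟨u, by dsimp only at e1 e2; rw [e1, e2, ← hx]; simp⟩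

theorem adjoint_inverse_toOp {A : H →L[ℂ] H} (hk : LinearMap.ker (A : H →ₗ[ℂ] H) = ⊥)
    (hd : DenseRange A) :
    (toOp A).inverse† = (toOp (ContinuousLinearMap.adjoint A)).inverse := by
  refine eq_of_eq_graph ?_
  ext ⟨x, y⟩
  rw [mem_graph_adjoint (dense_domain_inverse_toOp hd),
    mem_graph_inverse_toOp (denseRange_iff_ker_adjoint.1 hd)]
  simp only [mem_graph_inverse_toOp hk]
  constructor
  · intro h
    refine ext_inner_right ℂ fun v => ?_
    rw [ContinuousLinearMap.adjoint_inner_left]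
    exact (h _ v rfl).symm
  · rintro rfl a b rfl
    rw [ContinuousLinearMap.adjoint_inner_left]

/-- An everywhere defined accretive operator is bounded. -/
theorem continuous_of_accretive (R : H →ₗ[ℂ] H) (hR : ∀ x, 0 ≤ (inner ℂ x (R x)).re) :
    Continuous R := by
  refine R.continuous_of_seq_closed_graph fun u x y hu hRu => ?_
  -- The closed graph theorem asks for `w = 0`. Minty's trick: accretivity at `u n - x + t z`, in
  -- the limit `n → ∞`, then divided by `t` and `t → 0`, gives `Re (w, z) ≥ 0` for every `z`.
  set w : H := y - R x with hw
  have key : ∀ z, 0 ≤ (inner ℂ z w).re := by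
    intro z
    have h1 : ∀ t : ℝ, 0 < t → 0 ≤ (inner ℂ z w).re + t * (inner ℂ z (R z)).re := by
      intro t ht
      have h2 : Filter.Tendsto (fun n => (inner ℂ (u n - x + (t : ℂ) • z)
          (R (u n) - R x + (t : ℂ) • R z)).re) Filter.atTop
          (nhds (inner ℂ (x - x + (t : ℂ) • z) (y - R x + (t : ℂ) • R z)).re) :=
        (Complex.continuous_re.tendsto _).comp
          (((hu.sub_const x).add_const _).inner ((hRu.sub_const _).add_const _))
      have h3 := ge_of_tendsto' h2 fun n => by
        have := hR (u n - x + (t : ℂ) • z)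
        rwa [_root_.map_add, _root_.map_sub, _root_.map_smul] at this
      rw [sub_self, zero_add, ← hw, inner_add_right, inner_smul_left, inner_smul_left,
        inner_smul_right, Complex.conj_ofReal, Complex.add_re, Complex.re_ofReal_mul,
        Complex.re_ofReal_mul, Complex.re_ofReal_mul] at h3
      have h4 : 0 ≤ t * ((inner ℂ z w).re + t * (inner ℂ z (R z)).re) := by linarith
      exact nonneg_of_mul_nonneg_right h4 ht
    have h5 : Filter.Tendsto (fun t : ℝ => (inner ℂ z w).re + t * (inner ℂ z (R z)).re)
        (nhdsWithin 0 (Set.Ioi 0)) (nhds ((inner ℂ z w).re + 0 * (inner ℂ z (R z)).re)) :=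
      tendsto_nhdsWithin_of_tendsto_nhds (Continuous.tendsto (by fun_prop) 0)
    have h6 := ge_of_tendsto h5 (Filter.eventually_of_mem self_mem_nhdsWithin fun t ht => h1 t ht)
    simpa using h6
  have h7 := key (-w)
  rw [inner_neg_left, Complex.neg_re, re_inner_self] at h7
  have h8 : ‖w‖ = 0 := by nlinarith [norm_nonneg w]
  exact sub_eq_zero.1 (norm_eq_zero.1 h8)

-- The Cayley transform `(A - 1)(A + 1)⁻¹` of an accretive `A` is a contraction; this identity keeps
-- track of the exact loss of norm.
omit [CompleteSpace H] in
theorem norm_sub_sq_eq (A : H →L[ℂ] H) (x : H) :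
    ‖A x - x‖ ^ 2 = ‖A x + x‖ ^ 2 - 4 * (inner ℂ x (A x)).re := by
  have h1 := norm_sub_sq (𝕜 := ℂ) (A x) x
  have h2 := norm_add_sq (𝕜 := ℂ) (A x) x
  have h3 : RCLike.re (inner ℂ (A x) x) = (inner ℂ x (A x)).re := by
    rw [← inner_conj_symm, RCLike.conj_re]; rfl
  rw [h1, h2, h3]; ring

/-- Bounded accretive square roots are unique. -/
theorem eq_of_sq_eq_sq {R T : H →L[ℂ] H} (hR : ∀ x, 0 ≤ (inner ℂ x (R x)).re) {C : ℝ}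
    (hT : ∀ x, ‖T x‖ ^ 2 ≤ C * (inner ℂ x (T x)).re) (hT0 : ∀ x, 0 ≤ (inner ℂ x (T x)).re)
    (hd : DenseRange T) (h : R ^ 2 = T ^ 2) : R = T := by
  have hRT : ∀ x, R (R x) = T (T x) := fun x => by
    simpa [pow_two] using DFunLike.congr_fun h x
  suffices hz : ∀ z, R (T z) = T (T z) by
    have := hd.equalizer R.continuous T.continuous (funext hz)
    exact DFunLike.coe_injective this
  intro z
  set Y : H →L[ℂ] H := R - T with hY
  -- `R Y = R² - R T = T² - R T = -Y T`. The goal becomes `Y T = 0`.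
  have hYs : ∀ x, R (Y x) = - Y (T x) := fun x => by
    simp [hY, hRT]
  choose f hf using surjective_add_of_accretive hT0
  -- the orbit of `z` under the Cayley transform of `T`
  let u : ℕ → H := fun n => Nat.rec z (fun _ v => f (T v - v)) n
  have hu : ∀ n, u (n + 1) + T (u (n + 1)) = T (u n) - u n := fun n => hf _
  -- The losses telescope, so `Re (T u n, u n)` is summable, and `hT` turns this into `T (u n) → 0`.
  have hstep : ∀ n, ‖T (u (n + 1)) + u (n + 1)‖ ^ 2 =
      ‖T (u n) + u n‖ ^ 2 - 4 * (inner ℂ (u n) (T (u n))).re := fun n => by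
    rw [add_comm (T (u (n + 1))), hu, norm_sub_sq_eq]
  have hsum : ∀ n, ∑ i ∈ Finset.range n, (inner ℂ (u i) (T (u i))).re ≤
      ‖T (u 0) + u 0‖ ^ 2 := by
    intro n
    have : 4 * ∑ i ∈ Finset.range n, (inner ℂ (u i) (T (u i))).re =
        ‖T (u 0) + u 0‖ ^ 2 - ‖T (u n) + u n‖ ^ 2 := by
      induction n with
      | zero => simp
      | succ n ih => rw [Finset.sum_range_succ, mul_add, ih, hstep]; ring
    have h0 : 0 ≤ ∑ i ∈ Finset.range n, (inner ℂ (u i) (T (u i))).re :=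
      Finset.sum_nonneg fun i _ => hT0 _
    nlinarith [sq_nonneg ‖T (u n) + u n‖]
  have hs : Summable fun i => (inner ℂ (u i) (T (u i))).re :=
    summable_of_sum_range_le (fun i => hT0 _) hsum
  have hlim : Filter.Tendsto (fun n => ‖T (u n)‖ ^ 2) Filter.atTop (nhds 0) :=
    squeeze_zero (fun n => sq_nonneg _) (fun n => hT (u n))
      (by simpa using hs.tendsto_atTop_zero.const_mul C)
  have hlim2 : Filter.Tendsto (fun n => ‖T (u n)‖) Filter.atTop (nhds 0) := by
    have := hlim.sqrt
    simpa [Real.sqrt_sq (norm_nonneg _)] using this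
  -- `Y` intertwines the two Cayley transforms
  set c : ℕ → H := fun n => Y (T (u n)) with hc
  have hcs : ∀ n, R (c (n + 1)) - c (n + 1) = R (c n) + c n := by
    intro n
    have h1 := congrArg (fun v => Y (T v)) (hu n)
    simp only [_root_.map_add, _root_.map_sub] at h1
    simp only [hc, hYs]
    rw [← sub_eq_zero] at h1 ⊢
    rw [← neg_eq_zero, ← h1]
    abel
  -- The sign in `hYs` makes `c` run backwards under the Cayley transform of `R`: these norms
  -- increase, yet they tend to `0` with `c n`. So they vanish, and accretivity turns `R (c 0) = -c
  -- 0` into `c 0 = 0`.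
  have hmono : ∀ n, ‖R (c 0) + c 0‖ ^ 2 ≤ ‖R (c n) + c n‖ ^ 2 := by
    intro n
    induction n with
    | zero => exact le_rfl
    | succ n ih =>
      rw [← hcs n, norm_sub_sq_eq] at ih
      linarith [hR (c (n + 1))]
  have hc0 : Filter.Tendsto c Filter.atTop (nhds 0) := by
    have := (Y.continuous.tendsto 0).comp (tendsto_zero_iff_norm_tendsto_zero.2 hlim2)
    rwa [_root_.map_zero] at this
  have hRc : Filter.Tendsto (fun n => ‖R (c n) + c n‖ ^ 2) Filter.atTop (nhds 0) := by
    have := ((((R.continuous.tendsto 0).comp hc0).add hc0).norm).pow 2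
    simpa using this
  have h0 : ‖R (c 0) + c 0‖ ^ 2 ≤ 0 := ge_of_tendsto' hRc hmono
  have h1 : R (c 0) = - c 0 := by
    have : ‖R (c 0) + c 0‖ = 0 := by nlinarith [norm_nonneg (R (c 0) + c 0)]
    exact eq_neg_of_add_eq_zero_left (norm_eq_zero.1 this)
  have h2 := hR (c 0)
  rw [h1, inner_neg_right, Complex.neg_re, re_inner_self] at h2
  have h3 : ‖c 0‖ = 0 := by nlinarith [norm_nonneg (c 0)]
  have h4 : Y (T z) = 0 := norm_eq_zero.1 h3
  exact sub_eq_zero.1 (by simpa [hY] using h4)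

/-- The inverse of any accretive root `S` is accretive and defined on all of `H`, because `S S =
T⁻²` is onto. It is therefore bounded with square `T²`, and `eq_of_sq_eq_sq` identifies it with `T`.
-/
theorem isMAccretiveSqrt_inverse_iff {T : H →L[ℂ] H}
    (hk : LinearMap.ker (T : H →ₗ[ℂ] H) = ⊥) (hd : DenseRange T) {C : ℝ}
    (hT : ∀ x, ‖T x‖ ^ 2 ≤ C * (inner ℂ x (T x)).re) (hT0 : ∀ x, 0 ≤ (inner ℂ x (T x)).re)
    (S : H →ₗ.[ℂ] H) :
    (toOp (T ^ 2)).inverse.IsMAccretiveSqrt S ↔ S = (toOp T).inverse := by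
  constructor
  · rintro ⟨⟨hacc, -, -⟩, hS⟩
    rw [isAccretive_iff_graph] at hacc
    have hG : ∀ x z, (∃ y, (x, y) ∈ S.graph ∧ (y, z) ∈ S.graph) ↔ T (T z) = x := by
      intro x z
      rw [← mem_graph_opProd, hS, mem_graph_inverse_toOp (ker_pow_two hk)]
      simp [pow_two]
    have hkS : LinearMap.ker S.toFun = ⊥ := by
      rw [LinearMap.ker_eq_bot']
      intro u hu
      have h1 : ((u : H), (0 : H)) ∈ S.graph := (mem_graph_iff _).2 ⟨u, rfl, hu⟩
      have h2 := (hG u 0).1 ⟨0, h1, S.graph.zero_mem⟩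
      simp only [_root_.map_zero] at h2
      exact Subtype.ext h2.symm
    have hfun : ∀ z, ∃ y, (y, z) ∈ S.graph := fun z =>
      let ⟨y, _, h⟩ := (hG _ z).2 rfl
      ⟨y, h⟩
    have hdom : S.inverse.domain = ⊤ := by
      rw [inverse_domain, eq_top_iff]
      rintro z -
      obtain ⟨y, hy⟩ := hfun z
      obtain ⟨u, -, h⟩ := (mem_graph_iff _).1 hy
      exact ⟨u, h⟩
    have hin : ∀ {x y}, (x, y) ∈ S.inverse.graph ↔ (y, x) ∈ S.graph := by
      intro x y
      rw [inverse_graph hkS]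
      constructor
      · rintro ⟨⟨a, b⟩, hab, e⟩
        obtain ⟨rfl, rfl⟩ := Prod.mk.inj e
        exact hab
      · intro h
        exact ⟨(y, x), h, rfl⟩
    let R₀ : H →ₗ[ℂ] H := S.inverse.toFun ∘ₗ
      (LinearMap.id.codRestrict S.inverse.domain fun x => hdom ▸ Submodule.mem_top)
    have hR₀ : ∀ z, (R₀ z, z) ∈ S.graph := fun z => hin.1 (mem_graph S.inverse ⟨z, _⟩)
    have hR₀' : ∀ y z, (y, z) ∈ S.graph → R₀ z = y := fun y z h =>
      mem_graph_snd_inj _ (hin.2 (hR₀ z)) (hin.2 h) rfl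
    have hpos : ∀ x, 0 ≤ (inner ℂ x (R₀ x)).re := fun x => by
      rw [← inner_conj_symm, Complex.conj_re]
      exact hacc _ _ (hR₀ x)
    let R : H →L[ℂ] H := ⟨R₀, continuous_of_accretive R₀ hpos⟩
    have hRT : R = T := by
      refine eq_of_sq_eq_sq hpos hT hT0 hd ?_
      ext z
      have := (hG (R₀ (R₀ z)) z).1 ⟨_, hR₀ _, hR₀ z⟩
      rw [pow_two, pow_two]
      exact this.symm
    refine eq_of_eq_graph ?_
    ext ⟨x, y⟩
    rw [mem_graph_inverse_toOp hk, ← hRT]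
    exact ⟨hR₀' x y, fun h => h ▸ hR₀ y⟩
  · rintro rfl
    exact ⟨isMAccretive_inverse_toOp hT0 hk hd, opProd_inverse_toOp hk⟩

omit [CompleteSpace H] in
theorem accretiveSqrt_eq {B S : H →ₗ.[ℂ] H} (h : ∀ S', B.IsMAccretiveSqrt S' ↔ S' = S) :
    B.accretiveSqrt = S := by
  have hex : ∃ S', B.IsMAccretiveSqrt S' := ⟨S, (h S).2 rfl⟩
  rw [accretiveSqrt, dif_pos hex]
  exact (h _).1 hex.choose_spec

end KatoExample

/-! ### The factorisation `T = Q (1 + i W)` -/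

namespace KatoExample

open LinearPMap

variable {H : Type*} [NormedAddCommGroup H] [InnerProductSpace ℂ H] [CompleteSpace H]

/-- The operator `Q (1 + i W)`. -/
noncomputable def cayleyProd (Q W : H →L[ℂ] H) : H →L[ℂ] H :=
  Q + Complex.I • (Q * W)

/-- `W` is an isometry with `Q W` selfadjoint, where `Q` is nonnegative with trivial kernel. -/
structure IsometricFactor (Q W : H →L[ℂ] H) : Prop where
  pos : Q.IsPositive
  ker_eq : LinearMap.ker (Q : H →ₗ[ℂ] H) = ⊥
  isom : ∀ x, ContinuousLinearMap.adjoint W (W x) = x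
  comm : ∀ x, Q (W x) = ContinuousLinearMap.adjoint W (Q x)

namespace IsometricFactor

variable {Q W : H →L[ℂ] H}

theorem neg (h : IsometricFactor Q W) : IsometricFactor Q (-W) :=
  ⟨h.pos, h.ker_eq, fun x => by simp [h.isom], fun x => by simp [h.comm]⟩

theorem inj (h : IsometricFactor Q W) {x y : H} (hxy : Q x = Q y) : x = y :=
  LinearMap.ker_eq_bot.1 h.ker_eq hxy

theorem adjoint_eq (h : IsometricFactor Q W) :
    ContinuousLinearMap.adjoint (cayleyProd Q W) = cayleyProd Q (-W) := by
  refine ContinuousLinearMap.ext fun x => ext_inner_right ℂ fun v => ?_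
  rw [ContinuousLinearMap.adjoint_inner_left]
  simp [cayleyProd, inner_add_right, inner_add_left, inner_smul_left, inner_smul_right, h.comm,
    h.pos.inner_left_eq_inner_right, ContinuousLinearMap.adjoint_inner_left,
    ContinuousLinearMap.adjoint_inner_right]

omit [CompleteSpace H] in
theorem cayleyProd_apply (x : H) : cayleyProd Q W x = Q (x + Complex.I • W x) := by
  simp [cayleyProd]

theorem cayleyProd_apply' (h : IsometricFactor Q W) (x : H) :
    cayleyProd Q W x = Q x + Complex.I • ContinuousLinearMap.adjoint W (Q x) := by
  simp [cayleyProd, h.comm]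

theorem norm_map (h : IsometricFactor Q W) (x : H) : ‖W x‖ = ‖x‖ := by
  have := ContinuousLinearMap.apply_norm_sq_eq_inner_adjoint_left W x
  rw [← sq_eq_sq₀ (norm_nonneg _) (norm_nonneg _), this]
  simp [h.isom]; norm_cast

theorem norm_adjoint_le (h : IsometricFactor Q W) (x : H) :
    ‖ContinuousLinearMap.adjoint W x‖ ≤ ‖x‖ := by
  have hW1 : ‖W‖ ≤ 1 := W.opNorm_le_bound zero_le_one fun y => by rw [h.norm_map, one_mul]
  refine (ContinuousLinearMap.le_opNorm _ _).trans ?_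
  rw [LinearIsometryEquiv.norm_map]
  exact mul_le_of_le_one_left (norm_nonneg _) hW1

/-- `Q W` is selfadjoint, so `Q` alone gives the real part of the form of `Q (1 + i W)`. -/
theorem im_inner (h : IsometricFactor Q W) (x : H) : (inner ℂ x (Q (W x))).im = 0 := by
  rw [← Complex.conj_eq_iff_im, inner_conj_symm, h.comm, ContinuousLinearMap.adjoint_inner_left,
    h.pos.inner_left_eq_inner_right, h.comm]

theorem re_inner_cayleyProd (h : IsometricFactor Q W) (x : H) :
    (inner ℂ x (cayleyProd Q W x)).re = (inner ℂ x (Q x)).re := by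
  simp [cayleyProd, h.im_inner]

theorem accretive (h : IsometricFactor Q W) (x : H) :
    0 ≤ (inner ℂ x (cayleyProd Q W x)).re := by
  rw [h.re_inner_cayleyProd]
  exact h.pos.re_inner_nonneg_right x

/-- The quantitative input to the uniqueness of square roots. With `S = Q^{1/2}`, the form `T = (1 +
i W*) Q` gives `‖T x‖ ≤ 2 ‖Q x‖ ≤ 2 ‖S‖ ‖S x‖`, while `Re (T x, x) = ‖S x‖²`. -/
theorem bound (h : IsometricFactor Q W) :
    ∃ C : ℝ, ∀ x, ‖cayleyProd Q W x‖ ^ 2 ≤ C * (inner ℂ x (cayleyProd Q W x)).re := by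
  set S := CFC.sqrt Q
  have hQ0 : 0 ≤ Q := (ContinuousLinearMap.nonneg_iff_isPositive Q).2 h.pos
  have hS : S * S = Q := CFC.sqrt_mul_sqrt_self Q hQ0
  have hSp : S.IsPositive := (ContinuousLinearMap.nonneg_iff_isPositive S).1 (CFC.sqrt_nonneg Q)
  have hSS : ∀ x, S (S x) = Q x := fun x => by rw [← hS]; rfl
  refine ⟨4 * ‖S‖ ^ 2, fun x => ?_⟩
  have h1 : (inner ℂ x (Q x)).re = ‖S x‖ ^ 2 := by
    rw [← hSS, ← hSp.inner_left_eq_inner_right, re_inner_self]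
  have h2 : ‖Q x‖ ≤ ‖S‖ * ‖S x‖ := by
    rw [← hSS]; exact S.le_opNorm _
  have h3 := h.norm_adjoint_le (Q x)
  have h4 : ‖cayleyProd Q W x‖ ≤ 2 * (‖S‖ * ‖S x‖) := by
    rw [h.cayleyProd_apply']
    refine (norm_add_le _ _).trans ?_
    rw [norm_smul, Complex.norm_I, one_mul]
    linarith
  rw [h.re_inner_cayleyProd, h1]
  calc _ ≤ (2 * (‖S‖ * ‖S x‖)) ^ 2 := by gcongr
    _ = _ := by ring

theorem ker_cayleyProd (h : IsometricFactor Q W) :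
    LinearMap.ker (cayleyProd Q W : H →ₗ[ℂ] H) = ⊥ := by
  rw [LinearMap.ker_eq_bot']
  intro x hx
  have hx' : cayleyProd Q W x = 0 := hx
  have h1 := h.re_inner_cayleyProd x
  rw [hx', inner_zero_right, Complex.zero_re] at h1
  have hQ0 : 0 ≤ Q := (ContinuousLinearMap.nonneg_iff_isPositive Q).2 h.pos
  have hS : CFC.sqrt Q * CFC.sqrt Q = Q := CFC.sqrt_mul_sqrt_self Q hQ0
  have hSp : (CFC.sqrt Q).IsPositive :=
    (ContinuousLinearMap.nonneg_iff_isPositive _).1 (CFC.sqrt_nonneg Q)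
  have hSS : ∀ x, CFC.sqrt Q (CFC.sqrt Q x) = Q x := fun x => by
    conv_rhs => rw [← hS]
    rfl
  rw [← hSS, ← hSp.inner_left_eq_inner_right, re_inner_self] at h1
  have h2 : CFC.sqrt Q x = 0 := by
    rw [← norm_eq_zero]; nlinarith [norm_nonneg (CFC.sqrt Q x)]
  refine h.inj ?_
  rw [← hSS, h2, _root_.map_zero, _root_.map_zero]

theorem denseRange (h : IsometricFactor Q W) : DenseRange (cayleyProd Q W) := by
  rw [denseRange_iff_ker_adjoint, h.adjoint_eq]
  exact h.neg.ker_cayleyProd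

theorem denseRange_left (h : IsometricFactor Q W) : DenseRange Q := by
  rw [denseRange_iff_ker_adjoint, h.pos.isSelfAdjoint.adjoint_eq]
  exact h.ker_eq

theorem adjoint_pow_two (h : IsometricFactor Q W) :
    ContinuousLinearMap.adjoint (cayleyProd Q W ^ 2) = cayleyProd Q (-W) ^ 2 := by
  rw [← h.adjoint_eq]
  exact star_pow _ _

theorem denseRange_pow_two (h : IsometricFactor Q W) : DenseRange ⇑(cayleyProd Q W ^ 2) := by
  rw [denseRange_iff_ker_adjoint, h.adjoint_pow_two]
  exact ker_pow_two h.neg.ker_cayleyProd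

theorem sqrt_iff (h : IsometricFactor Q W) (S : H →ₗ.[ℂ] H) :
    (toOp (cayleyProd Q W ^ 2)).inverse.IsMAccretiveSqrt S ↔
      S = (toOp (cayleyProd Q W)).inverse :=
  let ⟨_, hC⟩ := h.bound
  isMAccretiveSqrt_inverse_iff h.ker_cayleyProd h.denseRange hC h.accretive S

theorem adjoint_inverse (h : IsometricFactor Q W) :
    (toOp (cayleyProd Q W ^ 2)).inverse† = (toOp (cayleyProd Q (-W) ^ 2)).inverse := by
  rw [adjoint_inverse_toOp (ker_pow_two h.ker_cayleyProd) h.denseRange_pow_two, h.adjoint_pow_two]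

end IsometricFactor

/-! ### Inverse Cayley transforms of nonunitary isometries -/

/-- An eigenvector of the adjoint of an isometry, with unimodular eigenvalue, is an eigenvector of
the isometry. -/
theorem apply_eq_of_adjoint_apply_eq {W : H →L[ℂ] H}
    (hW : ∀ x, ContinuousLinearMap.adjoint W (W x) = x) {c : ℂ} (hc : ‖c‖ = 1) {x : H}
    (hx : ContinuousLinearMap.adjoint W x = c • x) : W x = conj c • x := by
  have h1 : inner ℂ (W x) (W x) = inner ℂ x x := by
    rw [← ContinuousLinearMap.adjoint_inner_left, hW]
  have h2 : inner ℂ (W x) x = c * inner ℂ x x := by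
    rw [← ContinuousLinearMap.adjoint_inner_right, hx, inner_smul_right]
  have h3 : inner ℂ x (W x) = conj c * inner ℂ x x := by
    rw [← ContinuousLinearMap.adjoint_inner_left, hx, inner_smul_left]
  have h4 : conj c * c = 1 := by
    rw [Complex.conj_mul', hc]; simp
  rw [← sub_eq_zero, ← inner_self_eq_zero (𝕜 := ℂ), inner_sub_left, inner_sub_right,
    inner_sub_right, inner_smul_left, inner_smul_left, inner_smul_right, inner_smul_right, h1, h2,
    h3, Complex.conj_conj]
  -- The expansion of `‖W x - conj c • x‖²` collapses since `|c| = 1`.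
  linear_combination (-inner ℂ x x) * h4

/-- `W* m = 0` reads `W* y = -i y`; then `W y = i y`, so `y + i W y = 0`. -/
theorem eq_zero_of_add_I_smul {W : H →L[ℂ] H}
    (hW : ∀ x, ContinuousLinearMap.adjoint W (W x) = x) {y m : H}
    (hy : y + Complex.I • W y = m) (hm : ContinuousLinearMap.adjoint W m = 0) : m = 0 := by
  subst hy
  have h1 : ContinuousLinearMap.adjoint W y = (-Complex.I) • y := by
    rw [_root_.map_add, _root_.map_smul, hW] at hm
    rw [neg_smul]
    exact eq_neg_of_add_eq_zero_left hm
  rw [apply_eq_of_adjoint_apply_eq hW (by simp) h1, smul_smul]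
  simp

/-- The inverse Cayley transform `(1 + i W)⁻¹ (1 - i W)` of an isometry that is not unitary. -/
structure IsCayleyInverse (W : H →L[ℂ] H) (F : H →ₗ.[ℂ] H) : Prop where
  isom : ∀ x, ContinuousLinearMap.adjoint W (W x) = x
  ker_eq : ∀ x, x + Complex.I • W x = 0 → x = 0
  exists_ker : ∃ m, m ≠ 0 ∧ ContinuousLinearMap.adjoint W m = 0
  mem_graph_iff : ∀ x z, (x, z) ∈ F.graph ↔ z + Complex.I • W z = x - Complex.I • W x

namespace IsCayleyInverse

variable {W : H →L[ℂ] H} {F : H →ₗ.[ℂ] H}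

theorem mem_graph (h : IsCayleyInverse W F) (y : H) :
    (y + Complex.I • W y, y - Complex.I • W y) ∈ F.graph := by
  rw [h.mem_graph_iff]
  simp only [_root_.map_add, _root_.map_sub, _root_.map_smul, smul_add, smul_sub, smul_smul]
  abel

/-- With `mem_graph`, this parametrises the graph of `F` by all of `H`; the parameter is `y = (x +
z) / 2`. -/
theorem exists_of_mem_graph (h : IsCayleyInverse W F) {x z : H} (hxz : (x, z) ∈ F.graph) :
    ∃ y, x = y + Complex.I • W y ∧ z = y - Complex.I • W y := by
  rw [h.mem_graph_iff] at hxz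
  have h1 : Complex.I • W z + Complex.I • W x = x - z := by
    rw [eq_sub_iff_add_eq, add_right_comm, add_comm _ z, hxz]
    abel
  have h2 : Complex.I • W ((1 / 2 : ℂ) • (x + z)) = (1 / 2 : ℂ) • (x - z) := by
    rw [← h1, _root_.map_smul, _root_.map_add]
    module
  refine ⟨(1 / 2 : ℂ) • (x + z), ?_, ?_⟩
  · rw [h2]; module
  · rw [h2]; module

theorem inner_I_smul (h : IsCayleyInverse W F) (x y : H) :
    inner ℂ (Complex.I • W x) (Complex.I • W y) = inner ℂ x y := by
  rw [inner_smul_left, inner_smul_right, ← ContinuousLinearMap.adjoint_inner_left, h.isom,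
    ← mul_assoc]
  simp

theorem inner_eq (h : IsCayleyInverse W F) {x z x' z' : H} (hx : (x, z) ∈ F.graph)
    (hx' : (x', z') ∈ F.graph) : inner ℂ x z' = - inner ℂ z x' := by
  obtain ⟨y, rfl, rfl⟩ := h.exists_of_mem_graph hx
  obtain ⟨y', rfl, rfl⟩ := h.exists_of_mem_graph hx'
  simp only [inner_add_left, inner_sub_left, inner_add_right, inner_sub_right, h.inner_I_smul]
  ring

theorem re_inner_eq (h : IsCayleyInverse W F) {x z : H} (hx : (x, z) ∈ F.graph) :
    (inner ℂ x z).re = 0 := by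
  have h1 := congrArg Complex.re (h.inner_eq hx hx)
  rw [Complex.neg_re, ← inner_conj_symm z x, Complex.conj_re] at h1
  linarith

theorem mem_domain (h : IsCayleyInverse W F) (y : H) : y + Complex.I • W y ∈ F.domain :=
  mem_domain_of_mem_graph (h.mem_graph y)

/-- A vector orthogonal to `ran (1 + i W)` is an eigenvector of `W*` for `-i`, hence of `W` for `i`,
and so lies in `ker (1 + i W)`. -/
theorem dense_domain (h : IsCayleyInverse W F) : Dense (F.domain : Set H) := by
  rw [Submodule.dense_iff_topologicalClosure_eq_top, Submodule.topologicalClosure_eq_top_iff,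
    Submodule.eq_bot_iff]
  intro z hz
  have h1 : ∀ y, inner ℂ (y + Complex.I • W y) z = 0 := fun y => hz _ (h.mem_domain y)
  have h2 : ContinuousLinearMap.adjoint W z = (-Complex.I) • z := by
    have h3 : z - Complex.I • ContinuousLinearMap.adjoint W z = 0 := by
      refine ext_inner_left ℂ fun y => ?_
      rw [inner_zero_right, ← h1 y, inner_sub_right, inner_smul_right,
        ContinuousLinearMap.adjoint_inner_right, inner_add_left, inner_smul_left]
      simp [sub_eq_add_neg]
    rw [sub_eq_zero] at h3
    conv_rhs => rw [h3, smul_smul]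
    simp
  refine h.ker_eq z ?_
  rw [apply_eq_of_adjoint_apply_eq h.isom (by simp) h2, smul_smul]
  simp

theorem isMAccretive (h : IsCayleyInverse W F) : F.IsMAccretive := by
  refine ⟨isAccretive_iff_graph.2 fun x y hxy => (h.re_inner_eq hxy).ge, h.dense_domain, -1,
    by simp, fun y => ?_⟩
  obtain ⟨u, e1, e2⟩ := (LinearPMap.mem_graph_iff _).1 (h.mem_graph ((1 / 2 : ℂ) • y))
  refine ⟨u, ?_⟩
  dsimp only at e1 e2
  rw [e1, e2]
  module

/-- `m ⊥ ran W`, so `y + i W y` and `y - i W y` have the same inner product with `m`: the vectors of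
`ker W*` are deficiency vectors. -/
theorem adjoint_mem_graph (h : IsCayleyInverse W F) {m : H}
    (hm : ContinuousLinearMap.adjoint W m = 0) : (m, m) ∈ F†.graph := by
  rw [mem_graph_adjoint h.dense_domain]
  intro a b hab
  obtain ⟨y, rfl, rfl⟩ := h.exists_of_mem_graph hab
  rw [inner_sub_right, inner_add_right, inner_smul_right, ← ContinuousLinearMap.adjoint_inner_left,
    hm]
  simp

theorem eq_zero_of_mem_domain (h : IsCayleyInverse W F) {m : H}
    (hm : ContinuousLinearMap.adjoint W m = 0) (hd : m ∈ F.domain) : m = 0 := by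
  obtain ⟨y, hy, -⟩ := h.exists_of_mem_graph (LinearPMap.mem_graph F ⟨m, hd⟩)
  exact eq_zero_of_add_I_smul h.isom hy.symm hm

/-- Skew-symmetry gives `-F ≤ F*`; a deficiency vector makes the inclusion strict. -/
theorem domain_lt (h : IsCayleyInverse W F) : F.domain < F†.domain := by
  refine lt_of_le_not_ge (fun x hx => ?_) fun hle => ?_
  · refine mem_domain_of_mem_graph (y := -F ⟨x, hx⟩) ?_
    rw [mem_graph_adjoint h.dense_domain]
    intro a b hab
    rw [inner_neg_left]
    exact h.inner_eq (LinearPMap.mem_graph F ⟨x, hx⟩) hab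
  · obtain ⟨m, hm0, hm⟩ := h.exists_ker
    exact hm0 (h.eq_zero_of_mem_domain hm
      (hle (mem_domain_of_mem_graph (h.adjoint_mem_graph hm))))

theorem isSymmetricOp (h : IsCayleyInverse W F) : (Complex.I • F).IsSymmetricOp := by
  refine ⟨h.dense_domain, fun u v => ?_⟩
  rw [LinearPMap.smul_apply, LinearPMap.smul_apply, inner_smul_left, inner_smul_right,
    h.inner_eq (LinearPMap.mem_graph F u) (LinearPMap.mem_graph F v)]
  simp

theorem isMaximalSymmetric (h : IsCayleyInverse W F) : (Complex.I • F).IsMaximalSymmetric := by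
  refine ⟨h.isSymmetricOp, fun A hA hle => (eq_of_le_of_domain_eq hle ?_).symm⟩
  refine le_antisymm hle.1 fun x hx => ?_
  -- `-i A` extends `F`, and `F + 1` is onto: the parameter `w / 2` gives `u ∈ dom F` with `u + F u
  -- = w`. Then `v = x - u` satisfies `A v = -i v`, impossible for a symmetric `A` unless `v = 0`.
  set w := x - Complex.I • A ⟨x, hx⟩ with hw
  set y := (1 / 2 : ℂ) • w with hy
  obtain ⟨u, e1, e2⟩ := (LinearPMap.mem_graph_iff _).1 (h.mem_graph y)
  dsimp only at e1 e2
  have hu : (u : H) ∈ A.domain := hle.1 u.2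
  have hAu : A ⟨u, hu⟩ = Complex.I • F u := (hle.2 (x := u) (y := ⟨u, hu⟩) rfl).symm
  set v : A.domain := ⟨x, hx⟩ - ⟨u, hu⟩ with hv
  have hAv : (v : H) = Complex.I • A v := by
    rw [hv, LinearPMap.map_sub, hAu, smul_sub, smul_smul, Complex.I_mul_I, Submodule.coe_sub]
    have : (u : H) + F u = w := by rw [e1, e2, hy]; module
    rw [hw, ← sub_eq_zero] at this
    rw [← sub_eq_zero, ← neg_eq_zero, ← this]
    module
  have h1 := hA.2 v v
  have h2 : inner ℂ (v : H) (v : H) = 0 := by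
    have h3 : A v = -(Complex.I • (v : H)) := by
      conv_rhs => rw [hAv, smul_smul, Complex.I_mul_I]
      simp
    rw [h3, inner_neg_left, inner_neg_right, inner_smul_left, inner_smul_right,
      Complex.conj_I] at h1
    have h4 : (2 * Complex.I) * inner ℂ (v : H) (v : H) = 0 := by linear_combination h1
    exact (mul_eq_zero.1 h4).resolve_left (by simp)
  have h3 : (v : H) = 0 := inner_self_eq_zero.1 h2
  have h4 : x = u := sub_eq_zero.1 h3
  rw [h4]
  exact u.2

theorem not_isSelfAdjoint (h : IsCayleyInverse W F) : ¬ IsSelfAdjoint (Complex.I • F) := by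
  intro hsa
  obtain ⟨m, hm0, hm⟩ := h.exists_ker
  have h1 : m ∈ (Complex.I • F)†.domain := by
    refine mem_adjoint_domain_of_exists m ⟨-(Complex.I • m), fun u => ?_⟩
    rw [LinearPMap.smul_apply, inner_smul_right,
      (mem_graph_adjoint h.dense_domain).1 (h.adjoint_mem_graph hm) _ _ (LinearPMap.mem_graph F u)]
    simp [inner_neg_left, inner_smul_left]
  rw [isSelfAdjoint_def.1 hsa] at h1
  exact hm0 (h.eq_zero_of_mem_domain hm h1)

end IsCayleyInverse

end KatoExample

/-! ### Sectors as inequalities between real and imaginary parts -/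

namespace LinearPMap

/-- Rescaling to a unit vector leaves the argument unchanged. Unlike the condition on `arg`, the
inequality passes to limits. -/
theorem IsSectorialWith.abs_im_le {H : Type*} [NormedAddCommGroup H] [InnerProductSpace ℂ H]
    {A : H →ₗ.[ℂ] H} {α : ℝ} (h : A.IsSectorialWith α) (u : A.domain) :
    |(inner ℂ (u : H) (A u)).im| ≤ Real.tan α * (inner ℂ (u : H) (A u)).re := by
  obtain ⟨h0, h1, h2⟩ := h
  rcases eq_or_ne (u : H) 0 with hu | hu
  · rw [hu]; simp
  have hn : ‖(u : H)‖ ≠ 0 := norm_ne_zero_iff.2 hu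
  set c : ℂ := ((‖(u : H)‖⁻¹ : ℝ) : ℂ) with hc
  have hz : inner ℂ ((c • u : A.domain) : H) (A (c • u)) =
      (((‖(u : H)‖ ^ 2)⁻¹ : ℝ) : ℂ) * inner ℂ (u : H) (A u) := by
    rw [map_smul, Submodule.coe_smul, inner_smul_left, inner_smul_right, hc, Complex.conj_ofReal,
      ← mul_assoc, ← Complex.ofReal_mul, ← sq, inv_pow]
  have harg := h2 ⟨c • u, by
    rw [Submodule.coe_smul, norm_smul, hc, Complex.norm_real, norm_inv, norm_norm,
      inv_mul_cancel₀ hn], rfl⟩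
  rw [hz, Set.mem_ofPred_eq, Complex.arg_real_mul _ (by positivity)] at harg
  set z := inner ℂ (u : H) (A u)
  have hb := abs_le.1 harg
  have hcos : 0 < Real.cos z.arg := Real.cos_pos_of_mem_Ioo ⟨by linarith, by linarith⟩
  have hcosα : 0 < Real.cos α := Real.cos_pos_of_mem_Ioo ⟨by linarith, by linarith⟩
  have hmul : z.re * Real.tan z.arg = z.im := by
    rw [← Complex.norm_mul_cos_arg, ← Complex.norm_mul_sin_arg, mul_assoc, mul_comm (Real.cos _),
      Real.tan_mul_cos hcos.ne']
  have hre : 0 ≤ z.re := by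
    rw [← Complex.norm_mul_cos_arg]; positivity
  have htan : |Real.tan z.arg| ≤ Real.tan α := by
    have hm := Real.strictMonoOn_tan.monotoneOn
    refine abs_le.2 ⟨?_, ?_⟩
    · rw [← Real.tan_neg]
      exact hm ⟨by linarith, by linarith⟩ ⟨by linarith, by linarith⟩ hb.1
    · exact hm ⟨by linarith, by linarith⟩ ⟨by linarith, by linarith⟩ hb.2
  rw [← hmul, abs_mul, abs_of_nonneg hre, mul_comm]
  exact mul_le_mul_of_nonneg_right htan hre

end LinearPMap

theorem Complex.abs_arg_le_pi_div_four {z : ℂ} (h : |z.im| ≤ z.re) : |z.arg| ≤ Real.pi / 4 := by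
  rcases eq_or_ne z 0 with rfl | hz
  · rw [Complex.arg_zero, abs_zero]; positivity
  by_contra! hlt
  have h1 : Real.cos |z.arg| < Real.cos (Real.pi / 4) :=
    Real.cos_lt_cos_of_nonneg_of_le_pi (by positivity) (Complex.abs_arg_le_pi z) hlt
  have hre : 0 ≤ z.re := (abs_nonneg _).trans h
  have hn : 0 < ‖z‖ := norm_pos_iff.2 hz
  rw [Real.cos_abs, Complex.cos_arg hz, Real.cos_pi_div_four, div_lt_iff₀ hn] at h1
  have h2 : z.re ^ 2 < (√2 / 2 * ‖z‖) ^ 2 := by gcongr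
  rw [mul_pow, div_pow, Real.sq_sqrt (by norm_num), Complex.sq_norm, Complex.normSq_apply] at h2
  have h3 := sq_le_sq' (neg_le_of_abs_le h) (le_of_abs_le h)
  linarith

/-! ### The square of `Q (1 + i W)`: form, sectoriality and ranges -/

namespace KatoExample

open LinearPMap

variable {H : Type*} [NormedAddCommGroup H] [InnerProductSpace ℂ H] [CompleteSpace H]

namespace IsometricFactor

variable {Q W : H →L[ℂ] H}

/-- Expansion of `(T² x, x) = (T x, T* x)` with `T = (1 + i W*) Q` and `T* = (1 - i W*) Q`. -/
theorem inner_sq (h : IsometricFactor Q W) (x : H) :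
    inner ℂ x ((cayleyProd Q W ^ 2) x) =
      ((‖Q x‖ ^ 2 - ‖ContinuousLinearMap.adjoint W (Q x)‖ ^ 2 : ℝ) : ℂ) +
        ((2 * (inner ℂ (Q x) (ContinuousLinearMap.adjoint W (Q x))).re : ℝ) : ℂ) * Complex.I := by
  have h1 : inner ℂ x ((cayleyProd Q W ^ 2) x) =
      inner ℂ (cayleyProd Q (-W) x) (cayleyProd Q W x) := by
    rw [← h.adjoint_eq, ContinuousLinearMap.adjoint_inner_left, pow_two]; rfl
  rw [h1, h.cayleyProd_apply', h.neg.cayleyProd_apply']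
  have h2 : ∀ y : H, inner ℂ y y = ((‖y‖ ^ 2 : ℝ) : ℂ) := fun y => by
    rw [inner_self_eq_norm_sq_to_K]; norm_cast
  have h3 := Complex.add_conj (inner ℂ (Q x) (ContinuousLinearMap.adjoint W (Q x)))
  rw [inner_conj_symm] at h3
  rw [← h3, Complex.ofReal_sub, ← h2, ← h2]
  simp only [_root_.map_neg, _root_.neg_apply, smul_neg, inner_add_left, inner_add_right,
    inner_neg_left, inner_smul_left, inner_smul_right, Complex.conj_I]
  linear_combination (inner ℂ (ContinuousLinearMap.adjoint W (Q x))
    (ContinuousLinearMap.adjoint W (Q x))) * Complex.I_mul_I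

theorem re_inner_sq (h : IsometricFactor Q W) (x : H) :
    (inner ℂ x ((cayleyProd Q W ^ 2) x)).re =
      ‖Q x‖ ^ 2 - ‖ContinuousLinearMap.adjoint W (Q x)‖ ^ 2 := by
  rw [h.inner_sq, Complex.add_re, Complex.re_ofReal_mul, Complex.ofReal_re, Complex.I_re]
  ring

theorem im_inner_sq (h : IsometricFactor Q W) (x : H) :
    (inner ℂ x ((cayleyProd Q W ^ 2) x)).im =
      2 * (inner ℂ (Q x) (ContinuousLinearMap.adjoint W (Q x))).re := by
  rw [h.inner_sq, Complex.add_im, Complex.im_ofReal_mul, Complex.ofReal_im, Complex.I_im]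
  ring

theorem accretive_sq (h : IsometricFactor Q W) (x : H) :
    0 ≤ (inner ℂ x ((cayleyProd Q W ^ 2) x)).re := by
  rw [h.re_inner_sq, sub_nonneg]
  have := h.norm_adjoint_le (Q x)
  gcongr

theorem not_forall_abs_im_le (h : IsometricFactor Q W)
    (hW : ∃ m, m ≠ 0 ∧ ContinuousLinearMap.adjoint W m = 0) (c : ℝ) :
    ¬ ∀ x, |(inner ℂ x ((cayleyProd Q W ^ 2) x)).im| ≤
      c * (inner ℂ x ((cayleyProd Q W ^ 2) x)).re := by
  intro hc
  -- The form depends on `x` only through `Q x`, and `ran Q` is dense.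
  have h1 : ∀ q, |2 * (inner ℂ q (ContinuousLinearMap.adjoint W q)).re| ≤
      c * (‖q‖ ^ 2 - ‖ContinuousLinearMap.adjoint W q‖ ^ 2) := by
    intro q
    refine h.denseRange_left.induction_on (p := fun q =>
      |2 * (inner ℂ q (ContinuousLinearMap.adjoint W q)).re| ≤
      c * (‖q‖ ^ 2 - ‖ContinuousLinearMap.adjoint W q‖ ^ 2)) q ?_ fun x => ?_
    · refine isClosed_le ?_ ?_
      · exact (continuous_const.mul (Complex.continuous_re.comp
          (continuous_id.inner (ContinuousLinearMap.continuous _)))).abs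
      · exact continuous_const.mul ((continuous_norm.pow 2).sub
          ((ContinuousLinearMap.continuous _).norm.pow 2))
    · have := hc x
      rwa [h.re_inner_sq, h.im_inner_sq] at this
  -- At `q = W p` the right side vanishes, since `W* W = 1`.
  have h2 : ∀ p, (inner ℂ (W p) p).re = 0 := by
    intro p
    have := h1 (W p)
    rw [h.isom, h.norm_map, sub_self, mul_zero] at this
    have := abs_nonpos_iff.1 this
    linarith
  have h3 : (W + ContinuousLinearMap.adjoint W : H →L[ℂ] H).toLinearMap = 0 := by
    rw [← inner_map_self_eq_zero]
    intro p
    have h4 := Complex.add_conj (inner ℂ (W p) p)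
    rw [inner_conj_symm, h2, mul_zero, Complex.ofReal_zero] at h4
    simp only [ContinuousLinearMap.coe_coe, _root_.add_apply, inner_add_left,
      ContinuousLinearMap.adjoint_inner_left]
    exact h4
  obtain ⟨m, hm0, hm⟩ := hW
  have h4 : W m + ContinuousLinearMap.adjoint W m = 0 := LinearMap.congr_fun h3 m
  rw [hm, add_zero] at h4
  have h5 := h.isom m
  rw [h4, _root_.map_zero] at h5
  exact hm0 h5.symm

theorem not_isSectorial_sq (h : IsometricFactor Q W)
    (hW : ∃ m, m ≠ 0 ∧ ContinuousLinearMap.adjoint W m = 0) :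
    ¬ (toOp (cayleyProd Q W ^ 2)).IsSectorial := by
  rintro ⟨α, hα⟩
  exact h.not_forall_abs_im_le hW _ fun x => hα.abs_im_le ⟨x, trivial⟩

theorem not_isSectorial_inverse (h : IsometricFactor Q W)
    (hW : ∃ m, m ≠ 0 ∧ ContinuousLinearMap.adjoint W m = 0) :
    ¬ (toOp (cayleyProd Q W ^ 2)).inverse.IsSectorial := by
  rintro ⟨α, hα⟩
  refine h.not_forall_abs_im_le hW (Real.tan α) fun x => ?_
  obtain ⟨u, e1, e2⟩ := (LinearPMap.mem_graph_iff _).1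
    ((mem_graph_inverse_toOp (ker_pow_two h.ker_cayleyProd)).2
      (rfl : (cayleyProd Q W ^ 2) x = (cayleyProd Q W ^ 2) x))
  have := hα.abs_im_le u
  dsimp only at e1 e2
  rwa [e1, e2, ← inner_conj_symm, Complex.conj_re, Complex.conj_im, abs_neg] at this

theorem range_ne (h : IsometricFactor Q W)
    (hW : ∃ m, m ≠ 0 ∧ ContinuousLinearMap.adjoint W m = 0) :
    LinearMap.range (cayleyProd Q W : H →ₗ[ℂ] H) ≠
      LinearMap.range (cayleyProd Q (-W) : H →ₗ[ℂ] H) := by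
  intro he
  obtain ⟨m, hm0, hm⟩ := hW
  have h1 : Q m ∈ LinearMap.range (cayleyProd Q W : H →ₗ[ℂ] H) := by
    have h2 : Q m = cayleyProd Q W ((1 / 2 : ℂ) • m) + cayleyProd Q (-W) ((1 / 2 : ℂ) • m) := by
      rw [cayleyProd_apply, cayleyProd_apply, ← _root_.map_add]
      congr 1
      rw [_root_.neg_apply]
      module
    rw [h2]
    exact add_mem ⟨_, rfl⟩ (he ▸ ⟨_, rfl⟩)
  obtain ⟨y, hy⟩ := h1
  have hy' : cayleyProd Q W y = Q m := hy
  rw [cayleyProd_apply] at hy'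
  exact hm0 (eq_zero_of_add_I_smul h.isom (h.inj hy') hm)

theorem sq_apply (h : IsometricFactor Q W) (x : H) :
    (cayleyProd Q W ^ 2) x = Q (Q x - W (ContinuousLinearMap.adjoint W (Q x)) +
      Complex.I • (W (Q x) + ContinuousLinearMap.adjoint W (Q x))) := by
  have h1 : (cayleyProd Q W ^ 2) x = cayleyProd Q W (cayleyProd Q W x) := by rw [pow_two]; rfl
  rw [h1, cayleyProd_apply, h.cayleyProd_apply']
  congr 1
  rw [_root_.map_add, _root_.map_smul, smul_add, smul_smul, Complex.I_mul_I]
  module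

theorem range_sq_inf_range_sq (h : IsometricFactor Q W) {M : Submodule ℂ H}
    (hM : ∀ x, x ∈ M ↔ W (ContinuousLinearMap.adjoint W x) = x) :
    LinearMap.range (cayleyProd Q W ^ 2 : H →L[ℂ] H).toLinearMap ⊓
      LinearMap.range (cayleyProd Q (-W) ^ 2 : H →L[ℂ] H).toLinearMap = ⊥ ↔
    M ⊓ LinearMap.range (Q : H →ₗ[ℂ] H) = ⊥ := by
  simp only [Submodule.eq_bot_iff]
  constructor
  · rintro h1 x ⟨hxM, f, rfl⟩
    have hxM' : W (ContinuousLinearMap.adjoint W (Q f)) = Q f := (hM _).1 hxM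
    -- When `Q f ∈ M` the term `(1 - W W*) Q f` of `sq_apply` drops out; what remains is odd in `W`.
    have h2 : (cayleyProd Q W ^ 2) f = (cayleyProd Q (-W) ^ 2) (-f) := by
      rw [h.sq_apply, h.neg.sq_apply]
      congr 1
      simp only [_root_.map_neg, _root_.neg_apply, neg_neg, hxM']
      module
    have h3 : (cayleyProd Q W ^ 2) f = 0 := h1 _ ⟨⟨f, rfl⟩, ⟨-f, h2.symm⟩⟩
    have h4 : f = 0 := LinearMap.ker_eq_bot'.1 (ker_pow_two h.ker_cayleyProd) f h3
    rw [h4, _root_.map_zero]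
  · rintro h1 z ⟨⟨f, rfl⟩, ⟨g, hg⟩⟩
    have hg' : (cayleyProd Q (-W) ^ 2) g = (cayleyProd Q W ^ 2) f := hg
    rw [h.sq_apply, h.neg.sq_apply] at hg'
    have h2 := h.inj hg'
    simp only [_root_.map_neg, _root_.neg_apply, neg_neg] at h2
    -- The sum and difference separate the odd and even parts in `W`: `(1 - W W*) δ + i (W + W*) η =
    -- 0`. Applying `W*` kills the first term and leaves `W*² η = -η`.
    set η := Q (f + g) with hη
    set δ := Q (f - g) with hδ
    have h3 : δ - W (ContinuousLinearMap.adjoint W δ) +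
        Complex.I • (W η + ContinuousLinearMap.adjoint W η) = 0 := by
      rw [← sub_eq_zero] at h2
      rw [hη, hδ, ← neg_eq_zero, ← h2]
      simp only [_root_.map_add, _root_.map_sub]
      module
    have h4 : ContinuousLinearMap.adjoint W (ContinuousLinearMap.adjoint W η) = -η := by
      have h5 := congrArg (ContinuousLinearMap.adjoint W) h3
      rw [_root_.map_add, _root_.map_sub, h.isom, sub_self, zero_add, _root_.map_smul,
        _root_.map_zero, _root_.map_add, h.isom] at h5
      exact (neg_eq_of_add_eq_zero_right ((smul_eq_zero.1 h5).resolve_left Complex.I_ne_zero)).symm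
    have hV : W (W η) = -η := by
      -- The eigenvector principle for the isometry `W²`. It yields `W* η = -W η`, hence `W W* η =
      -- η` and `η ∈ M`.
      have := apply_eq_of_adjoint_apply_eq (W := W ^ 2) (x := η) (c := -1) (fun x => by
        rw [pow_two, ← ContinuousLinearMap.star_eq_adjoint, star_mul,
          ContinuousLinearMap.star_eq_adjoint]
        simp [h.isom]) (by simp) (by
        rw [pow_two, ← ContinuousLinearMap.star_eq_adjoint, star_mul,
          ContinuousLinearMap.star_eq_adjoint]
        simp [h4])
      simpa [pow_two] using this
    have h5 : ContinuousLinearMap.adjoint W η = - W η := by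
      rw [← h.isom (W η), hV, _root_.map_neg, neg_neg]
    have h6 : η = 0 := h1 η ⟨(hM η).2 (by rw [h5, _root_.map_neg, hV, neg_neg]), ⟨_, rfl⟩⟩
    rw [h6] at h3
    simp only [_root_.map_zero, add_zero, smul_zero] at h3
    have h7 : δ = 0 := h1 δ ⟨(hM δ).2 (sub_eq_zero.1 h3).symm, ⟨_, rfl⟩⟩
    have h8 : f + g = 0 := h.inj (by rw [_root_.map_zero]; exact h6)
    have h9 : f - g = 0 := h.inj (by rw [_root_.map_zero]; exact h7)
    have h10 : f = 0 := by
      have : f = (1 / 2 : ℂ) • ((f + g) + (f - g)) := by module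
      rw [this, h8, h9]; simp
    rw [h10, _root_.map_zero]

/-- `T⁻¹ T* = (1 + i W)⁻¹ (1 - i W)`, because the injective `Q` cancels. -/
theorem isCayleyInverse (h : IsometricFactor Q W)
    (hW : ∃ m, m ≠ 0 ∧ ContinuousLinearMap.adjoint W m = 0) :
    IsCayleyInverse W ((toOp (cayleyProd Q W)).inverse.opProd
      (toOp (cayleyProd Q (-W))).inverse.inverse) where
  isom := h.isom
  ker_eq x hx := LinearMap.ker_eq_bot'.1 h.ker_cayleyProd x (by
    change cayleyProd Q W x = 0
    rw [cayleyProd_apply, hx, _root_.map_zero])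
  exists_ker := hW
  mem_graph_iff x z := by
    rw [mem_graph_opProd]
    simp only [mem_graph_inverse_toOp h.ker_cayleyProd,
      inverse_inverse_toOp h.neg.ker_cayleyProd, exists_eq_left']
    rw [cayleyProd_apply, cayleyProd_apply, _root_.neg_apply, smul_neg, ← sub_eq_add_neg]
    exact ⟨fun e => h.inj e, fun e => e ▸ rfl⟩

end IsometricFactor

/-! ### The isometry attached to `Q` and `M` -/

section Root

variable {Q : H →L[ℂ] H} {M : Submodule ℂ H} [M.HasOrthogonalProjection]

theorem conj_starProjection_nonneg (hQ : Q.IsPositive) : 0 ≤ Q * M.starProjection * Q := by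
  rw [ContinuousLinearMap.nonneg_iff_isPositive]
  have h := (ContinuousLinearMap.IsPositive.of_isStarProjection
    (isStarProjection_starProjection (U := M))).conj_adjoint Q
  rwa [hQ.isSelfAdjoint.adjoint_eq] at h

theorem rootQPQ_mul_self (hQ : Q.IsPositive) :
    rootQPQ Q M * rootQPQ Q M = Q * M.starProjection * Q :=
  CFC.sqrt_mul_sqrt_self _ (conj_starProjection_nonneg hQ)

theorem rootQPQ_isPositive : (rootQPQ Q M).IsPositive :=
  (ContinuousLinearMap.nonneg_iff_isPositive _).1 (CFC.sqrt_nonneg _)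

omit [CompleteSpace H] in
theorem orthogonal_starProjection : Mᗮ.starProjection = 1 - M.starProjection :=
  Submodule.starProjection_orthogonal' M

/-- Operator monotonicity of the square root applied to `Q P_M Q ≤ Q²`. This bounds the imaginary
part of `T₀` by its real part, whence the angle `π / 4`. -/
theorem rootQPQ_le (hQ : Q.IsPositive) : rootQPQ Q M ≤ Q := by
  have h : Q * M.starProjection * Q ≤ Q * Q := by
    rw [← sub_nonneg]
    have := conj_starProjection_nonneg (M := Mᗮ) hQ
    rw [orthogonal_starProjection] at this
    convert this using 1
    noncomm_ring
  have h2 := CFC.sqrt_le_sqrt _ _ h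
  rwa [CFC.sqrt_mul_self Q ((ContinuousLinearMap.nonneg_iff_isPositive _).2 hQ)] at h2

theorem norm_rootQPQ (hQ : Q.IsPositive) (x : H) :
    ‖rootQPQ Q M x‖ = ‖M.starProjection (Q x)‖ := by
  have h1 : rootQPQ Q M (rootQPQ Q M x) = Q (M.starProjection (Q x)) :=
    DFunLike.congr_fun (rootQPQ_mul_self hQ) x
  rw [← sq_eq_sq₀ (norm_nonneg _) (norm_nonneg _), ← re_inner_self, ← re_inner_self,
    rootQPQ_isPositive.inner_left_eq_inner_right, h1, ← hQ.inner_left_eq_inner_right,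
    Submodule.inner_starProjection_left_eq_right, Submodule.starProjection_eq_self_iff.2
      (Submodule.starProjection_apply_mem M _)]

/-- `(Q P_M Q)^{1/2} = Q W` for an isometry `W` with range `M`. -/
theorem exists_isometricFactor (hQ : Q.IsPositive)
    (hQker : LinearMap.ker (Q : H →ₗ[ℂ] H) = ⊥)
    (hMQ : Mᗮ ⊓ LinearMap.range (Q : H →ₗ[ℂ] H) = ⊥) :
    ∃ W : H →L[ℂ] H, IsometricFactor Q W ∧ Q * W = rootQPQ Q M ∧
      ∀ x, W (ContinuousLinearMap.adjoint W x) = M.starProjection x := by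
  set G := rootQPQ Q M with hG
  have hGG : ∀ x, G (G x) = Q (M.starProjection (Q x)) := fun x =>
    DFunLike.congr_fun (rootQPQ_mul_self hQ) x
  have hGa : ContinuousLinearMap.adjoint G = G := rootQPQ_isPositive.isSelfAdjoint.adjoint_eq
  have hGd : DenseRange G := by
    rw [denseRange_iff_ker_adjoint, hGa, LinearMap.ker_eq_bot']
    intro x hx
    have h1 : ‖G x‖ = 0 := norm_eq_zero.2 hx
    rw [hG, norm_rootQPQ hQ, norm_eq_zero, Submodule.starProjection_apply_eq_zero_iff] at h1
    have h2 : Q x ∈ (⊥ : Submodule ℂ H) := hMQ ▸ ⟨h1, ⟨x, rfl⟩⟩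
    exact LinearMap.ker_eq_bot'.1 hQker x h2
  -- `W` sends `G x` to `P_M Q x`: well defined and isometric by `norm_rootQPQ`, and extended from
  -- the dense range of `G`.
  set W : H →L[ℂ] H := LinearMap.extendOfNorm
    (M.starProjection * Q : H →L[ℂ] H).toLinearMap G.toLinearMap with hWdef
  have hWG : ∀ x, W (G x) = M.starProjection (Q x) := fun x =>
    LinearMap.extendOfNorm_eq (f := (M.starProjection * Q : H →L[ℂ] H).toLinearMap)
      (e := G.toLinearMap) hGd ⟨1, fun x => by
        rw [one_mul]; exact (norm_rootQPQ hQ x).ge⟩ x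
  have hWn : ∀ x, ‖W x‖ = ‖x‖ := fun x =>
    hGd.induction_on (p := fun x => ‖W x‖ = ‖x‖) x
      (isClosed_eq W.continuous.norm continuous_norm)
      fun x => by rw [hWG, hG, norm_rootQPQ hQ]
  have hWW : ∀ x, ContinuousLinearMap.adjoint W (W x) = x := fun x =>
    DFunLike.congr_fun ((ContinuousLinearMap.norm_map_iff_adjoint_comp_self W).1 hWn) x
  have hQW : Q * W = G := by
    refine DFunLike.coe_injective (hGd.equalizer (Q * W).continuous G.continuous (funext fun x => ?_))
    change Q (W (G x)) = G (G x)
    rw [hWG, hGG]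
  have hQWx : ∀ x, Q (W x) = G x := fun x => DFunLike.congr_fun hQW x
  have hWQ : ∀ x, ContinuousLinearMap.adjoint W (Q x) = G x := by
    intro x
    refine ext_inner_right ℂ fun y => ?_
    rw [ContinuousLinearMap.adjoint_inner_left, hQ.inner_left_eq_inner_right, hQWx,
      rootQPQ_isPositive.inner_left_eq_inner_right]
  have hI : IsometricFactor Q W := ⟨hQ, hQker, hWW, fun x => by rw [hQWx, hWQ]⟩
  refine ⟨W, hI, hQW, fun x => ?_⟩
  -- On the dense range of `Q`, after applying the injective `Q`, both sides become `G² x = Q P_M Q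
  -- x`.
  refine hI.denseRange_left.induction_on
    (p := fun x => W (ContinuousLinearMap.adjoint W x) = M.starProjection x) x
    (isClosed_eq (W.continuous.comp (ContinuousLinearMap.continuous _))
      (ContinuousLinearMap.continuous _)) fun x => hI.inj ?_
  rw [hQWx, hWQ, hGG]

theorem T₀_sq (hQ : Q.IsPositive) :
    T₀ Q M ^ 2 = Q * Mᗮ.starProjection * Q +
      Complex.I • (Q * rootQPQ Q M + rootQPQ Q M * Q) := by
  have h : T₀ Q M ^ 2 = Q * Q - rootQPQ Q M * rootQPQ Q M +
      Complex.I • (Q * rootQPQ Q M + rootQPQ Q M * Q) := by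
    rw [T₀, pow_two, add_mul, mul_add, mul_add, smul_mul_smul_comm, Complex.I_mul_I, mul_smul_comm,
      smul_mul_assoc]
    module
  rw [h, rootQPQ_mul_self hQ, orthogonal_starProjection]
  congr 1
  noncomm_ring

theorem rePart_T₀_sq (hQ : Q.IsPositive) :
    rePart (T₀ Q M ^ 2) = Q * Mᗮ.starProjection * Q := by
  have h1 : star (Q * Mᗮ.starProjection * Q) = Q * Mᗮ.starProjection * Q :=
    ((ContinuousLinearMap.nonneg_iff_isPositive _).1
      (conj_starProjection_nonneg (M := Mᗮ) hQ)).isSelfAdjoint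
  have h2 : star Q = Q := hQ.isSelfAdjoint
  have h3 : star (rootQPQ Q M) = rootQPQ Q M := rootQPQ_isPositive.isSelfAdjoint
  rw [rePart, T₀_sq hQ, ← ContinuousLinearMap.star_eq_adjoint, star_add, star_smul, star_add,
    star_mul Q (rootQPQ Q M), star_mul (rootQPQ Q M) Q, h1, h2, h3, Complex.star_def,
    Complex.conj_I]
  module

theorem ker_rePart_T₀_sq (hQ : Q.IsPositive) (hQker : LinearMap.ker (Q : H →ₗ[ℂ] H) = ⊥) :
    LinearMap.ker (rePart (T₀ Q M ^ 2) : H →ₗ[ℂ] H) = ⊥ ↔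
      M ⊓ LinearMap.range (Q : H →ₗ[ℂ] H) = ⊥ := by
  have hi : ∀ {x}, Q x = 0 → x = 0 := fun {x} hx => LinearMap.ker_eq_bot'.1 hQker x hx
  have h1 : ∀ x, rePart (T₀ Q M ^ 2) x = 0 ↔ Q x ∈ M := by
    intro x
    rw [rePart_T₀_sq hQ]
    have h2 : (Q * Mᗮ.starProjection * Q) x = Q (Mᗮ.starProjection (Q x)) := rfl
    rw [h2]
    constructor
    · intro h
      have h3 := hi h
      rwa [Submodule.starProjection_apply_eq_zero_iff,
        Submodule.orthogonal_orthogonal] at h3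
    · intro h
      have h3 : Mᗮ.starProjection (Q x) = 0 := by
        rw [Submodule.starProjection_apply_eq_zero_iff, Submodule.orthogonal_orthogonal]
        exact h
      rw [h3, _root_.map_zero]
  rw [LinearMap.ker_eq_bot', Submodule.eq_bot_iff]
  constructor
  · rintro h _ ⟨hM, x, rfl⟩
    have : x = 0 := h x ((h1 x).2 hM)
    rw [this, _root_.map_zero]
  · intro h x hx
    exact hi (h _ ⟨(h1 x).1 hx, x, rfl⟩)

theorem isSectorialWith_T₀ (hQ : Q.IsPositive) :
    (toOp (T₀ Q M)).IsSectorialWith (Real.pi / 4) := by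
  have hpi := Real.pi_pos
  refine ⟨by positivity, by linarith, ?_⟩
  rintro _ ⟨u, -, rfl⟩
  set x : H := u.1
  have hG : (rootQPQ Q M).IsPositive := rootQPQ_isPositive
  have h1 : inner ℂ x (toOp (T₀ Q M) u) =
      inner ℂ x (Q x) + Complex.I * inner ℂ x (rootQPQ Q M x) := by
    change inner ℂ x (T₀ Q M x) = _
    simp [T₀]
  have h2 := Complex.nonneg_iff.1 (hQ.inner_nonneg_right x)
  have h3 := Complex.nonneg_iff.1 (hG.inner_nonneg_right x)
  have h4 := ((ContinuousLinearMap.le_def _ _).1 (rootQPQ_le (M := M) hQ)).re_inner_nonneg_right x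
  have h5 : 0 ≤ (inner ℂ x (Q x)).re - (inner ℂ x (rootQPQ Q M x)).re := by
    simpa [inner_sub_right] using h4
  refine Complex.abs_arg_le_pi_div_four ?_
  rw [h1]
  simp only [Complex.add_re, Complex.add_im, Complex.mul_re, Complex.mul_im, Complex.I_re,
    Complex.I_im, ← h2.2, ← h3.2]
  rw [abs_of_nonneg (by linarith)]
  linarith

end Root

end KatoExample

/-! ### The theorem, by transfer to `Q (1 + i W)` -/

theorem mainTheorem3 {H : Type*} [NormedAddCommGroup H] [InnerProductSpace ℂ H] [CompleteSpace H]
    (Q : H →L[ℂ] H) (hQ : Q.IsPositive)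
    (hQker : LinearMap.ker (Q : H →ₗ[ℂ] H) = ⊥)
    (hQran : LinearMap.range (Q : H →ₗ[ℂ] H) ≠ ⊤)
    (M : Submodule ℂ H) [M.HasOrthogonalProjection] (hM : M ≠ ⊤)
    (hMQ : Mᗮ ⊓ LinearMap.range (Q : H →ₗ[ℂ] H) = ⊥) :
    -- the bounded operator `T₀`
    (KatoExample.toOp (KatoExample.T₀ Q M)).IsSectorialWith (Real.pi / 4) ∧
    LinearMap.ker (KatoExample.T₀ Q M : H →ₗ[ℂ] H) = ⊥ ∧
    Mᗮ ⊓ LinearMap.range (KatoExample.T₀ Q M : H →ₗ[ℂ] H) = ⊥ ∧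
    Mᗮ ⊓ LinearMap.range
      (ContinuousLinearMap.adjoint (KatoExample.T₀ Q M) : H →ₗ[ℂ] H) = ⊥ ∧
    LinearMap.range (KatoExample.T₀ Q M : H →ₗ[ℂ] H) ≠
      LinearMap.range (ContinuousLinearMap.adjoint (KatoExample.T₀ Q M) : H →ₗ[ℂ] H) ∧
    -- its square
    KatoExample.T₀ Q M ^ 2 = Q * Mᗮ.starProjection * Q +
      Complex.I • (Q * KatoExample.rootQPQ Q M + KatoExample.rootQPQ Q M * Q) ∧
    (KatoExample.toOp (KatoExample.T₀ Q M ^ 2)).IsAccretive ∧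
    ¬ (KatoExample.toOp (KatoExample.T₀ Q M ^ 2)).IsSectorial ∧
    List.TFAE [
      M ⊓ LinearMap.range (Q : H →ₗ[ℂ] H) = ⊥,
      LinearMap.ker (KatoExample.rePart (KatoExample.T₀ Q M ^ 2) : H →ₗ[ℂ] H) = ⊥,
      LinearMap.range (KatoExample.T₀ Q M ^ 2 : H →L[ℂ] H).toLinearMap ⊓
        LinearMap.range
          (ContinuousLinearMap.adjoint (KatoExample.T₀ Q M) ^ 2 : H →L[ℂ] H).toLinearMap = ⊥] ∧
    -- its inverse `B₀`
    (KatoExample.B₀ Q M).IsMAccretive ∧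
    ¬ (KatoExample.B₀ Q M).IsSectorial ∧
    -- the square roots of `B₀` and `B₀*` are well defined and have different domains
    (∃! S : H →ₗ.[ℂ] H, (KatoExample.B₀ Q M).IsMAccretiveSqrt S) ∧
    (∃! S : H →ₗ.[ℂ] H, (KatoExample.B₀ Q M)†.IsMAccretiveSqrt S) ∧
    (KatoExample.B₀ Q M).accretiveSqrt.domain ≠ (KatoExample.B₀ Q M)†.accretiveSqrt.domain ∧
    -- the operator `F₀ = B₀^{1/2} B₀*^{-1/2}`
    (KatoExample.F₀ Q M).IsMAccretive ∧
    (∀ h : (KatoExample.F₀ Q M).domain, (inner ℂ (h : H) (KatoExample.F₀ Q M h)).re = 0) ∧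
    (KatoExample.F₀ Q M).domain < (KatoExample.F₀ Q M)†.domain ∧
    (Complex.I • KatoExample.F₀ Q M).IsMaximalSymmetric ∧
    ¬ IsSelfAdjoint (Complex.I • KatoExample.F₀ Q M) ∧
    ((KatoExample.B₀ Q M).domain ⊓ (KatoExample.B₀ Q M)†.domain = ⊥ ↔
      M ⊓ LinearMap.range (Q : H →ₗ[ℂ] H) = ⊥) := by
  obtain ⟨W, h, hQW, hP⟩ := KatoExample.exists_isometricFactor (M := M) hQ hQker hMQ
  have hT : KatoExample.T₀ Q M = KatoExample.cayleyProd Q W := by rw [KatoExample.T₀, ← hQW, KatoExample.cayleyProd]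
  have hB : KatoExample.B₀ Q M = (LinearPMap.inverse (KatoExample.toOp (KatoExample.cayleyProd Q W ^ 2))) := by rw [KatoExample.B₀, hT]
  have hB' : (KatoExample.B₀ Q M)† = (LinearPMap.inverse (KatoExample.toOp (KatoExample.cayleyProd Q (-W) ^ 2))) := by
    rw [hB, h.adjoint_inverse]
  have hS : (KatoExample.B₀ Q M).accretiveSqrt = (KatoExample.toOp (KatoExample.cayleyProd Q W)).inverse := by
    rw [hB]; exact KatoExample.accretiveSqrt_eq h.sqrt_iff
  have hS' : (KatoExample.B₀ Q M)†.accretiveSqrt = (KatoExample.toOp (KatoExample.cayleyProd Q (-W))).inverse := by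
    rw [hB']; exact KatoExample.accretiveSqrt_eq h.neg.sqrt_iff
  -- For `m ∈ Mᗮ`, `W* m = W* (W W* m) = W* (P_M m) = 0`.
  have hW : ∃ m, m ≠ 0 ∧ ContinuousLinearMap.adjoint W m = 0 := by
    obtain ⟨m, hm, hm0⟩ := Submodule.exists_mem_ne_zero_of_ne_bot
      (mt Submodule.orthogonal_eq_bot_iff.1 hM)
    refine ⟨m, hm0, ?_⟩
    rw [← h.isom (ContinuousLinearMap.adjoint W m), hP,
      (Submodule.starProjection_apply_eq_zero_iff M).2 hm, map_zero]
  have hF : KatoExample.IsCayleyInverse W (KatoExample.F₀ Q M) := by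
    rw [KatoExample.F₀, hS, hS']; exact h.isCayleyInverse hW
  have hMW : ∀ x, x ∈ M ↔ W (ContinuousLinearMap.adjoint W x) = x := fun x => by
    rw [hP, Submodule.starProjection_eq_self_iff]
  have hrange : ∀ V : H →L[ℂ] H,
      Mᗮ ⊓ LinearMap.range (KatoExample.cayleyProd Q V : H →ₗ[ℂ] H) = ⊥ := fun V => by
    rw [eq_bot_iff, ← hMQ]
    refine inf_le_inf_left _ ?_
    rintro _ ⟨x, rfl⟩
    exact ⟨x + Complex.I • V x, (KatoExample.IsometricFactor.cayleyProd_apply x).symm⟩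
  have hsq := h.range_sq_inf_range_sq hMW
  refine ⟨KatoExample.isSectorialWith_T₀ hQ, ?_, ?_, ?_, ?_, KatoExample.T₀_sq hQ, ?_, ?_, ?_, ?_, ?_, ?_, ?_, ?_,
    hF.isMAccretive, fun x => hF.re_inner_eq (LinearPMap.mem_graph _ x), hF.domain_lt,
    hF.isMaximalSymmetric, hF.not_isSelfAdjoint, ?_⟩
  · rw [hT]; exact h.ker_cayleyProd
  · rw [hT]; exact hrange W
  · rw [hT, h.adjoint_eq]; exact hrange (-W)
  · rw [hT, h.adjoint_eq]; exact h.range_ne hW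
  · rw [hT]; exact fun x => h.accretive_sq x.1
  · rw [hT]; exact h.not_isSectorial_sq hW
  · tfae_have 1 ↔ 2 := (KatoExample.ker_rePart_T₀_sq hQ hQker).symm
    tfae_have 1 ↔ 3 := by rw [hT, h.adjoint_eq]; exact hsq.symm
    tfae_finish
  · rw [hB]
    exact KatoExample.isMAccretive_inverse_toOp h.accretive_sq (KatoExample.ker_pow_two h.ker_cayleyProd)
      h.denseRange_pow_two
  · rw [hB]; exact h.not_isSectorial_inverse hW
  · rw [hB]; exact ⟨_, (h.sqrt_iff _).2 rfl, fun S => (h.sqrt_iff S).1⟩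
  · rw [hB']; exact ⟨_, (h.neg.sqrt_iff _).2 rfl, fun S => (h.neg.sqrt_iff S).1⟩
  · rw [hS, hS', KatoExample.domain_inverse_toOp, KatoExample.domain_inverse_toOp]; exact h.range_ne hW
  · rw [hB', hB, KatoExample.domain_inverse_toOp, KatoExample.domain_inverse_toOp]; exact hsq
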